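/- Let $\mathcal H_X=\mathbb C^d$ and $\mathcal H_R=\mathbb C^m$, let $t\ge 1$, and let $r_1,\dots,r_t$ be natural numbers. For unitaries $U,V\in\mathcal U(d)$ let the risk be $R_U(V)=\int D\big(U|x\rangle\langle x|U^\dagger,\,V|x\rangle\langle x|V^\dagger\big)^2\,dx$, where $x$ is a uniformly random pure state of $\mathcal H_X$ and $D(\rho,\sigma)=\tfrac12\mathrm{Tr}|\rho-\sigma|$ is the trace distance. Consider the following training situation. * The target unitary $U$ is Haar distributed on $\mathcal U(d)$. Independently of $U$, training inputs $S_{\mathrm{in}}=(|\psi_1\rangle,\dots,|\psi_t\rangle)$ are drawn from a probability distribution that is concentrated on the $t$-tuples of pairwise orthogonal unit vectors of $\mathcal H_X\otimes\mathcal H_R$ in which $|\psi_j\rangle$ has Schmidt rank $r_j$ ($1\le j\le t$). * The training set is $S=\{(|\psi_j\rangle,|\phi_j\rangle)\}_{j=1}^t$ with $|\phi_j\rangle=(U\otimes I)|\psi_j\rangle$. The hypothesis unitary $V_S\in\mathcal U(d)$ is a measurable function of $S$ and, possibly, of internal randomness of the training algorithm that is independent of $U$ and $S_{\mathrm{in}}$.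 * Training is perfect: almost surely the loss $1-\frac1t\sum_{j=1}^t\big|\langle\psi_j|(U^\dagger V_S\otimes I)|\psi_j\rangle\big|^2$ is $0$, so that $\langle\psi_j|(U^\dagger V_S\otimes I)|\psi_j\rangle=e^{i\theta_j}$ with $\theta_j\in(-\pi,\pi]$. * The learned phases $\theta_1,\dots,\theta_t$ are independent and uniformly distributed on $(-\pi,\pi]$. Then the expected risk, where the expectation is over $U$, over the pairwise orthogonal training inputs and over the internal randomness, satisfies $$\mathbb E_U\big[\mathbb E_S^{\mathrm{ortho}}[R_U(V_S)]\big]\ \ge\ 1-\frac{\left(\sum_{j=1}^t r_j^2\right)+d+1}{d(d+1)} .$$ In particular, if all $r_j$ are equal to a fixed $r$, then $$\mathbb E_U\big[\mathbb E_S^{\mathrm{ortho}}[R_U(V_S)]\big]\ \ge\ 1-\frac{r^2t+d+1}{d(d+1)}=\Big(1-\frac1d\Big)-\frac{r^2}{d(d+1)}\,t,$$ so the bound decreases only linearly in $t$. -/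

import Mathlib

open MeasureTheory ProbabilityTheory
open scoped Kronecker

noncomputable section

namespace QNN

/-- The system `H_X` of dimension `d`. -/
abbrev HX (d : ℕ) : Type := EuclideanSpace ℂ (Fin d)

/-- The composite system `H_X ⊗ H_R` with `dim H_X = d`, `dim H_R = m`, in coordinates: the vector
`x ⊗ z` has the coordinates `x a * z b`. -/
abbrev HXR (d m : ℕ) : Type := EuclideanSpace ℂ (Fin d × Fin m)

/-- The unitary group `U(d)`. -/
abbrev UGroup (d : ℕ) : Type := Matrix.unitaryGroup (Fin d) ℂ

instance (d : ℕ) : MeasurableSpace (UGroup d) := borel _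

instance (d : ℕ) : BorelSpace (UGroup d) := ⟨rfl⟩

instance (d : ℕ) : CompactSpace (UGroup d) := by
  refine isCompact_iff_compactSpace.mp ?_
  have hc : IsClosed (Matrix.unitaryGroup (Fin d) ℂ : Set (Matrix (Fin d) (Fin d) ℂ)) := by
    have h : (Matrix.unitaryGroup (Fin d) ℂ : Set (Matrix (Fin d) (Fin d) ℂ))
        = {A | A * star A = 1} := by
      ext A
      exact Matrix.mem_unitaryGroup_iff
    rw [h]
    exact isClosed_eq (by fun_prop) continuous_const
  have hK : IsCompact (Set.univ.pi fun _ : Fin d => Set.univ.pi fun _ : Fin d =>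
      Metric.closedBall (0 : ℂ) 1) :=
    isCompact_univ_pi fun _ => isCompact_univ_pi fun _ => isCompact_closedBall _ _
  refine hK.of_isClosed_subset hc fun A hA => ?_
  simp only [Set.mem_pi, Set.mem_univ, true_implies, mem_closedBall_zero_iff]
  exact fun i j => entry_norm_bound_of_unitary hA i j

/-- The normalized Haar measure on `U(d)`. -/
def haarU (d : ℕ) : Measure (UGroup d) := Measure.haarMeasure ⊤

/-- The uniform distribution of pure states: normalized surface measure on the unit sphere. -/
def uniformState (d : ℕ) : Measure (Metric.sphere (0 : HX d) 1) :=
  ((volume : Measure (HX d)).toSphere Set.univ)⁻¹ • (volume : Measure (HX d)).toSphere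

/-- The action of a matrix on vectors. -/
def act {n : Type*} [Fintype n] (A : Matrix n n ℂ) (v : EuclideanSpace ℂ n) :
    EuclideanSpace ℂ n := WithLp.toLp 2 (A.mulVec v.ofLp)

/-- The density operator `|v⟩⟨v|`. -/
def density {n : Type*} (v : EuclideanSpace ℂ n) : Matrix n n ℂ :=
  Matrix.vecMulVec v.ofLp (star v.ofLp)

open scoped MatrixOrder ComplexOrder in
/-- The trace distance `D(ρ, σ) = 1/2 Tr |ρ - σ|` with `|A| = √(A† A)`. -/
def traceDist {n : Type*} [Fintype n] [DecidableEq n] (ρ σ : Matrix n n ℂ) : ℝ :=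
  1 / 2 * (CFC.sqrt ((ρ - σ).conjTranspose * (ρ - σ))).trace.re

/-- The risk `R_U(V) = ∫ D(|Ux⟩⟨Ux|, |Vx⟩⟨Vx|)² dx` over uniformly random pure states `x`. -/
def risk {d : ℕ} (U V : UGroup d) : ℝ :=
  ∫ x, traceDist (density (act U.1 x.1)) (density (act V.1 x.1)) ^ 2 ∂(uniformState d)

/-- The action of `A ⊗ I` on `H_X ⊗ H_R`. -/
def actX {d m : ℕ} (A : Matrix (Fin d) (Fin d) ℂ) (ψ : HXR d m) : HXR d m :=
  act (A ⊗ₖ (1 : Matrix (Fin m) (Fin m) ℂ)) ψ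

/-- `ψ` has Schmidt rank `r`: `ψ = ∑ₖ √cₖ ξₖ ⊗ ζₖ` with `r` summands, all `cₖ > 0`, and
orthonormal families `ξ` in `H_X` and `ζ` in `H_R`. -/
def HasSchmidtRank {d m : ℕ} (ψ : HXR d m) (r : ℕ) : Prop :=
  ∃ (c : Fin r → ℝ) (ξ : Fin r → HX d) (ζ : Fin r → EuclideanSpace ℂ (Fin m)),
    (∀ k, 0 < c k) ∧ Orthonormal ℂ ξ ∧ Orthonormal ℂ ζ ∧
    ∀ a b, ψ (a, b) = ∑ k, (Real.sqrt (c k) : ℂ) * (ξ k a * ζ k b)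

/-- The `t`-tuples of pairwise orthogonal (normalized) inputs with Schmidt ranks `r₁, …, rₜ`. -/
def orthoInputs (d m t : ℕ) (r : Fin t → ℕ) : Set (Fin t → HXR d m) :=
  {S | Orthonormal ℂ S ∧ ∀ j, HasSchmidtRank (S j) (r j)}

/-- The training samples `(ψⱼ, φⱼ)` with expected outputs `φⱼ = (U ⊗ I) ψⱼ`. -/
def trainingSet {d m t : ℕ} (U : UGroup d) (S : Fin t → HXR d m) :
    Fin t → HXR d m × HXR d m :=
  fun j => (S j, actX U.1 (S j))

/-- `⟨ψ | (U† V ⊗ I) | ψ⟩`. -/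
def overlap {d m : ℕ} (U V : UGroup d) (ψ : HXR d m) : ℂ :=
  inner ℂ ψ (actX ((star U.1) * V.1) ψ)

/-- The loss `1 - 1/t ∑ⱼ |⟨ψⱼ | (U† V ⊗ I) | ψⱼ⟩|²`. -/
def loss {d m t : ℕ} (U V : UGroup d) (S : Fin t → HXR d m) : ℝ :=
  1 - 1 / (t : ℝ) * ∑ j, ‖overlap U V (S j)‖ ^ 2

/-- The learned phase `θ ∈ (-π, π]` of a sample `ψ`: the argument of `⟨ψ | (U† V ⊗ I) | ψ⟩`. -/
def phase {d m : ℕ} (U V : UGroup d) (ψ : HXR d m) : ℝ := (overlap U V ψ).arg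

/-- The expected risk `E_U E_S [R_U(V_S)]`. The target `U` is Haar distributed, the inputs have the
distribution `μ`, `S` consists of the inputs and of their images under `U ⊗ I`, and the training
algorithm `V` sees only `S` and its internal randomness `ω`, which has the law `P`. -/
def expectedRisk {d m t : ℕ} {Ω : Type*} [MeasurableSpace Ω] (μ : Measure (Fin t → HXR d m))
    (P : Measure Ω) (V : (Fin t → HXR d m × HXR d m) × Ω → UGroup d) : ℝ :=
  ∫ U, ∫ S, ∫ ω, risk U (V (trainingSet U S, ω)) ∂P ∂μ ∂(haarU d)

end QNN

end

noncomputable section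

namespace QNN

/-! ### The trace distance of pure states -/

section TraceDistance

variable {n : Type*}

/-! For pure states the squared trace distance is one minus the squared overlap, and the fourth
moments of the uniform state give the risk as `1 - (|Tr U†V|² + d) / (d(d+1))` (`risk_eq`). So
everything reduces to `E |Tr U†V|² ≤ ∑ rⱼ² + 1` (`integral_norm_sq_trace_le`).

Put `W = U†V`. Perfect training is the equality case of Cauchy–Schwarz, so `ψⱼ` is an eigenvector of
`W ⊗ I` with eigenvalue `exp(iθⱼ)`, and so is every Schmidt vector of `ψⱼ` in `H_X` for `W`
(`IsSchmidtFamily.act_eq_smul`). Independent uniform phases are almost surely distinct, hence the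
Schmidt vectors of different inputs are orthogonal, and all of them form one orthonormal family on
which `W` has the trace `∑ rⱼ exp(iθⱼ)`.

The training data determine `U` only on the span of this family. If `T` fixes the span, then `U` and
`UT` yield the same training set and the same hypothesis, while Haar measure does not distinguish
them. Averaging `|Tr T†W|²` over suitable `T` removes the cross terms and leaves at most `|∑ rⱼ
exp(iθⱼ)|² + 1` (`exists_twirl`). Independence and zero mean of the `exp(iθⱼ)` turn the expectation
of the first term into `∑ rⱼ²` (`integral_norm_sq_sum_exp`). -/

lemma conjTranspose_density (u : EuclideanSpace ℂ n) :
    (density u).conjTranspose = density u := by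
  simp [density, Matrix.conjTranspose_vecMulVec]

variable [Fintype n]

lemma density_mul_density (u v : EuclideanSpace ℂ n) :
    density u * density v = inner ℂ u v • Matrix.vecMulVec u.ofLp (star v.ofLp) := by
  simp only [density, Matrix.vecMulVec_mul_vecMulVec, EuclideanSpace.inner_eq_star_dotProduct]
  rw [dotProduct_comm v.ofLp]
  ext i j
  simp [Matrix.vecMulVec_apply]
  ring

lemma density_mul_self {u : EuclideanSpace ℂ n} (hu : ‖u‖ = 1) :
    density u * density u = density u := by
  rw [density_mul_density, inner_self_eq_norm_sq_to_K, hu]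
  simp [density]

lemma density_mul_density_mul_self (u v : EuclideanSpace ℂ n) :
    density u * density v * density u = ((‖inner ℂ u v‖ ^ 2 : ℝ) : ℂ) • density u := by
  have h : (inner ℂ u v * inner ℂ v u : ℂ) = ((‖inner ℂ u v‖ ^ 2 : ℝ) : ℂ) := by
    rw [← inner_conj_symm v u, Complex.mul_conj, Complex.normSq_eq_norm_sq]
  rw [← h, density_mul_density, smul_mul_assoc]
  simp only [density, Matrix.vecMulVec_mul_vecMulVec, EuclideanSpace.inner_eq_star_dotProduct]
  rw [dotProduct_comm u.ofLp (star v.ofLp)]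
  ext i j
  simp [Matrix.vecMulVec_apply]
  ring

lemma trace_density (u : EuclideanSpace ℂ n) : (density u).trace = ((‖u‖ ^ 2 : ℝ) : ℂ) := by
  rw [density, Matrix.trace_vecMulVec, ← EuclideanSpace.inner_eq_star_dotProduct,
    inner_self_eq_norm_sq_to_K]
  simp

lemma trace_density_mul_density (u v : EuclideanSpace ℂ n) :
    (density u * density v).trace = ((‖inner ℂ u v‖ ^ 2 : ℝ) : ℂ) := by
  rw [density_mul_density, Matrix.trace_smul, Matrix.trace_vecMulVec,
    ← EuclideanSpace.inner_eq_star_dotProduct, smul_eq_mul, ← inner_conj_symm v u,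
    Complex.mul_conj, Complex.normSq_eq_norm_sq]

open scoped MatrixOrder ComplexOrder in
-- The difference `A` has eigenvalues `±√(1 - q)` and 0. Instead of diagonalizing, the proof uses
-- `A³ = (1 - q) A`, which makes `A² / √(1 - q)` the positive square root of `A²`; its trace is
-- `2√(1 - q)`.
theorem traceDist_density_sq [DecidableEq n] {u v : EuclideanSpace ℂ n} (hu : ‖u‖ = 1)
    (hv : ‖v‖ = 1) :
    traceDist (density u) (density v) ^ 2 = 1 - ‖inner ℂ u v‖ ^ 2 := by
  set A := density u - density v with hA
  have hAH : A.conjTranspose = A := by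
    simp [hA, Matrix.conjTranspose_sub, conjTranspose_density]
  set q : ℝ := ‖inner ℂ u v‖ ^ 2 with hq
  have hq' : ‖inner ℂ v u‖ ^ 2 = q := by rw [hq, norm_inner_symm]
  have hq1 : q ≤ 1 := by
    have := norm_inner_le_norm (𝕜 := ℂ) u v
    rw [hu, hv, mul_one] at this
    exact pow_le_one₀ (norm_nonneg _) this
  have huu := density_mul_self hu
  have hvv := density_mul_self hv
  have huvu := density_mul_density_mul_self u v
  have hvuv := density_mul_density_mul_self v u
  rw [hq'] at hvuv
  rw [← hq] at huvu
  have hA3 : A * A * A = (((1 - q : ℝ)) : ℂ) • A := by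
    have : A * A * A = density u * density u * density u - density u * density u * density v
        - density u * density v * density u + density u * (density v * density v)
        - (density v * density u) * density u + density v * density u * density v
        + (density v * density v) * density u - (density v * density v) * density v := by
      rw [hA]; noncomm_ring
    rw [this, huu, hvv, huu, huvu, hvuv, mul_assoc, huu, hvv, hA]
    push_cast
    module
  have htr : (A * A).trace = ((2 * (1 - q) : ℝ) : ℂ) := by
    have : A * A = density u * density u - density u * density v
        - density v * density u + density v * density v := by
      rw [hA]; noncomm_ring
    rw [this, Matrix.trace_add, Matrix.trace_sub, Matrix.trace_sub, huu, hvv, trace_density,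
      trace_density, trace_density_mul_density, trace_density_mul_density, hu, hv, hq', ← hq]
    push_cast
    ring
  have hpos : (A * A).PosSemidef := by
    conv => arg 1; arg 1; rw [← hAH]
    exact Matrix.posSemidef_conjTranspose_mul_self A
  rw [traceDist, ← hA, hAH]
  rcases hq1.lt_or_eq with hlt | heq
  · set δ := Real.sqrt (1 - q) with hδ
    have hδ0 : 0 < δ := Real.sqrt_pos.2 (by linarith)
    have hδ2 : δ ^ 2 = 1 - q := Real.sq_sqrt (by linarith)
    have hsq : CFC.sqrt (A * A) = ((δ⁻¹ : ℝ) : ℂ) • (A * A) := by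
      refine CFC.sqrt_unique ?_ ?_
      · rw [smul_mul_smul_comm, ← mul_assoc, hA3, smul_mul_assoc, smul_smul, ← hδ2]
        have : ((δ⁻¹ : ℝ) : ℂ) * ((δ⁻¹ : ℝ) : ℂ) * ((δ ^ 2 : ℝ) : ℂ) = 1 := by
          norm_cast
          field_simp
        rw [this, one_smul]
      · rw [Matrix.nonneg_iff_posSemidef]
        exact hpos.smul (by exact_mod_cast (inv_pos.2 hδ0).le)
    rw [hsq, Matrix.trace_smul, htr, smul_eq_mul, ← Complex.ofReal_mul, Complex.ofReal_re, ← hδ2]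
    field_simp
  -- For `q = 1` the division is impossible, but `A²` is positive semidefinite of trace 0.
  · have h0 : A * A = 0 := by
      refine hpos.trace_eq_zero_iff.1 ?_
      rw [htr, heq]
      simp
    rw [h0, CFC.sqrt_zero, heq]
    simp

end TraceDistance

/-! ### Unitary invariance of the uniform distribution -/

instance uniformState_isProbabilityMeasure (d : ℕ) [NeZero d] :
    IsProbabilityMeasure (uniformState d) := by
  have : Nonempty (Fin d) := ⟨0⟩
  refine ⟨?_⟩
  rw [uniformState, Measure.smul_apply, smul_eq_mul]
  refine ENNReal.inv_mul_cancel ?_ (measure_ne_top _ _)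
  exact fun h => Measure.toSphere_ne_zero (volume : Measure (HX d))
    (Measure.measure_univ_eq_zero.1 h)

lemma act_one {d : ℕ} (v : HX d) : act 1 v = v := by simp [act]

lemma act_mul {n : Type*} [Fintype n] (A B : Matrix n n ℂ) (v : EuclideanSpace ℂ n) :
    act (A * B) v = act A (act B v) := by
  simp [act, Matrix.mulVec_mulVec]

lemma inner_act_act {n : Type*} [Fintype n]
    (A B : Matrix n n ℂ) (u v : EuclideanSpace ℂ n) :
    inner ℂ (act A u) (act B v) = inner ℂ u (act (A.conjTranspose * B) v) := by
  simp only [EuclideanSpace.inner_eq_star_dotProduct, act, Matrix.star_mulVec]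
  rw [← Matrix.mulVec_mulVec, dotProduct_comm, ← Matrix.dotProduct_mulVec, dotProduct_comm]

/-- A unitary matrix as a linear isometry. -/
def unitaryIsometry {d : ℕ} (U : UGroup d) : HX d ≃ₗᵢ[ℂ] HX d where
  toFun := act U.1
  invFun := act (star U.1)
  map_add' := fun x y => by simp [act, Matrix.mulVec_add]
  map_smul' := fun c x => by simp [act, Matrix.mulVec_smul]
  left_inv := fun x => by
    rw [← act_mul, Unitary.star_mul_self_of_mem U.2, act_one]
  right_inv := fun x => by
    rw [← act_mul, Unitary.mul_star_self_of_mem U.2, act_one]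
  norm_map' := fun x => by
    have h : inner ℂ (act U.1 x) (act U.1 x) = inner ℂ x x := by
      rw [inner_act_act, ← Matrix.star_eq_conjTranspose, Unitary.star_mul_self_of_mem U.2, act_one]
    change ‖act U.1 x‖ = ‖x‖
    rw [inner_self_eq_norm_sq_to_K, inner_self_eq_norm_sq_to_K] at h
    have h' : ‖act U.1 x‖ ^ 2 = ‖x‖ ^ 2 := by exact_mod_cast h
    exact (sq_eq_sq₀ (norm_nonneg _) (norm_nonneg _)).1 h'

lemma norm_act {d : ℕ} (U : UGroup d) (v : HX d) : ‖act U.1 v‖ = ‖v‖ :=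
  (unitaryIsometry U).norm_map v

lemma measurePreserving_act {d : ℕ} (U : UGroup d) :
    MeasurePreserving (fun x : HX d => act U.1 x) volume volume :=
  ((unitaryIsometry U).toIsometryEquiv.toRealLinearIsometryEquivOfMapZero
    ((unitaryIsometry U).map_zero)).measurePreserving

/-- The action of a unitary matrix on the unit sphere. -/
def actSphere {d : ℕ} (U : UGroup d) (x : Metric.sphere (0 : HX d) 1) :
    Metric.sphere (0 : HX d) 1 :=
  ⟨act U.1 x.1, by simp [norm_act]⟩

lemma continuous_actSphere {d : ℕ} (U : UGroup d) : Continuous (actSphere U) :=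
  Continuous.subtype_mk ((unitaryIsometry U).continuous.comp continuous_subtype_val) _

open scoped Pointwise in
lemma measurePreserving_actSphere {d : ℕ} (U : UGroup d) :
    -- The surface measure of `s` is, up to a constant, the volume of the cone `(0,1) • s`. Forming
    -- cones commutes with preimages under a unitary, and a unitary preserves volume.
    MeasurePreserving (actSphere U) (uniformState d) (uniformState d) := by
  refine ⟨(continuous_actSphere U).measurable, ?_⟩
  rw [uniformState, Measure.map_smul]
  congr 1
  ext s hs
  rw [Measure.map_apply (continuous_actSphere U).measurable hs,
    Measure.toSphere_apply' _ ((continuous_actSphere U).measurable hs),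
    Measure.toSphere_apply' _ hs]
  congr 1
  have hpre : Set.Ioo (0 : ℝ) 1 • (Subtype.val '' (actSphere U ⁻¹' s))
      = (fun x : HX d => act U.1 x) ⁻¹' (Set.Ioo (0 : ℝ) 1 • (Subtype.val '' s)) := by
    ext x
    simp only [Set.mem_smul, Set.mem_image, Set.mem_preimage]
    constructor
    · rintro ⟨c, hc, _, ⟨y, hy, rfl⟩, rfl⟩
      refine ⟨c, hc, _, ⟨_, hy, rfl⟩, ?_⟩
      simp [actSphere, act, Matrix.mulVec_smul]
    · rintro ⟨c, hc, _, ⟨y, hy, rfl⟩, h⟩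
      refine ⟨c, hc, _, ⟨actSphere (star U) y, ?_, rfl⟩, ?_⟩
      · have : actSphere U (actSphere (star U) y) = y := by
          ext1
          simp [actSphere, ← act_mul, act_one]
        simpa [this] using hy
      · have : x = act (star U.1) (c • y.1) := by
          rw [h, ← act_mul, Unitary.star_mul_self_of_mem U.2, act_one]
        rw [this]
        simp [actSphere, act, Matrix.mulVec_smul]
  rw [hpre]
  exact MeasurePreserving.measure_preimage_equiv
    (f := (unitaryIsometry U).toHomeomorph.toMeasurableEquiv) (measurePreserving_act U) _

lemma integral_comp_actSphere {d : ℕ} (U : UGroup d) (f : Metric.sphere (0 : HX d) 1 → ℂ)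
    (hf : Continuous f) :
    ∫ x, f (actSphere U x) ∂(uniformState d) = ∫ x, f x ∂(uniformState d) := by
  conv_rhs => rw [← (measurePreserving_actSphere U).map_eq]
  rw [integral_map (continuous_actSphere U).aemeasurable hf.aestronglyMeasurable]

/-! ### Fourth moments of the uniform distribution on the sphere -/

section Moments

variable {d : ℕ}

/-- The fourth moment `E[x̄ᵢ xⱼ xₖ x̄ₗ]` of a uniformly random pure state. -/
def moment (i j k l : Fin d) : ℂ :=
  ∫ x, star (x.1 i) * x.1 j * x.1 k * star (x.1 l) ∂(uniformState d)

lemma continuous_coord (i : Fin d) :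
    Continuous fun x : Metric.sphere (0 : HX d) 1 => x.1 i := by fun_prop

lemma continuous_moment_integrand (i j k l : Fin d) :
    Continuous fun x : Metric.sphere (0 : HX d) 1 =>
      star (x.1 i) * x.1 j * x.1 k * star (x.1 l) := by
  have := continuous_coord (d := d)
  fun_prop

lemma integrable_uniformState [NeZero d] {f : Metric.sphere (0 : HX d) 1 → ℂ}
    (hf : Continuous f) : Integrable f (uniformState d) :=
  hf.integrable_of_hasCompactSupport (HasCompactSupport.of_compactSpace f)

lemma moment_comp_act (U : UGroup d) (i j k l : Fin d) :
    ∫ x, star (act U.1 x.1 i) * act U.1 x.1 j * act U.1 x.1 k * star (act U.1 x.1 l)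
      ∂(uniformState d) = moment i j k l :=
  integral_comp_actSphere U _ (continuous_moment_integrand i j k l)

/-- The diagonal unitary with a phase at one place. -/
def phaseGate (p : Fin d) : UGroup d :=
  ⟨Matrix.diagonal fun i => if i = p then Complex.I else 1, by
    rw [Matrix.mem_unitaryGroup_iff, Matrix.star_eq_conjTranspose, Matrix.diagonal_conjTranspose,
      Matrix.diagonal_mul_diagonal, ← Matrix.diagonal_one]
    congr 1
    ext i
    by_cases h : i = p <;> simp [h]⟩

lemma act_phaseGate (p i : Fin d) (x : HX d) :
    act (phaseGate p).1 x i = (if i = p then Complex.I else 1) * x i := by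
  simp [act, phaseGate, Matrix.mulVec_diagonal]

lemma moment_eq_phase_mul (p i j k l : Fin d) :
    moment i j k l = star (if i = p then Complex.I else 1) * (if j = p then Complex.I else 1) *
      (if k = p then Complex.I else 1) * star (if l = p then Complex.I else 1) *
        moment i j k l := by
  conv_lhs => rw [← moment_comp_act (phaseGate p)]
  rw [moment, ← integral_const_mul]
  congr 1
  ext x
  simp only [act_phaseGate, star_mul']
  ring

lemma moment_eq_zero_of_phase {i j k l : Fin d} (p : Fin d)
    (h : star (if i = p then Complex.I else 1) * (if j = p then Complex.I else 1) *
      (if k = p then Complex.I else 1) * star (if l = p then Complex.I else 1) ≠ 1) :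
    moment i j k l = 0 := by
  have hm := moment_eq_phase_mul p i j k l
  set c := star (if i = p then Complex.I else 1) * (if j = p then Complex.I else 1) *
      (if k = p then Complex.I else 1) * star (if l = p then Complex.I else 1)
  have : (1 - c) * moment i j k l = 0 := by linear_combination hm
  rcases mul_eq_zero.1 this with h' | h'
  · exact absurd (sub_eq_zero.1 h').symm h
  · exact h'

/-- Unless the conjugated indices match the others in pairs, some coordinate's phase does not
cancel. The phase is `I` and not `-1` because for `i = l` with `j, k ≠ i` it enters squared. -/
lemma moment_eq_zero {i j k l : Fin d} (h : ¬ ((i = j ∧ k = l) ∨ (i = k ∧ j = l))) :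
    moment i j k l = 0 := by
  by_cases hli : l = i
  · by_cases hji : j = i
    · by_cases hki : k = i
      · subst hli hji hki
        simp at h
      · refine moment_eq_zero_of_phase i ?_
        simp [hli, hji, hki, Complex.ext_iff]
    · by_cases hki : k = i <;> refine moment_eq_zero_of_phase i ?_ <;>
        simp [hli, hji, hki, Complex.ext_iff]
      norm_num
  · by_cases hji : j = i
    · by_cases hki : k = i
      · refine moment_eq_zero_of_phase i ?_
        simp [hli, hji, hki, Complex.ext_iff]
      · have hkl : k ≠ l := fun h' => h (Or.inl ⟨hji.symm, h'⟩)
        refine moment_eq_zero_of_phase l ?_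
        simp [Ne.symm hli, hji, hkl, Complex.ext_iff]
    · by_cases hki : k = i
      · have hjl : j ≠ l := fun h' => h (Or.inr ⟨hki.symm, h'⟩)
        refine moment_eq_zero_of_phase l ?_
        simp [Ne.symm hli, hki, hjl, Complex.ext_iff]
      · refine moment_eq_zero_of_phase i ?_
        simp [hli, hji, hki, Complex.ext_iff]

/-- The unitary that permutes the coordinates. -/
def permGate (σ : Equiv.Perm (Fin d)) : UGroup d :=
  ⟨σ.permMatrix ℂ, by
    rw [Matrix.mem_unitaryGroup_iff, Matrix.star_eq_conjTranspose, Matrix.conjTranspose_permMatrix,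
      ← Matrix.permMatrix_mul]
    simp⟩

lemma act_permGate (σ : Equiv.Perm (Fin d)) (x : HX d) (i : Fin d) :
    act (permGate σ).1 x i = x (σ i) := by
  simp [act, permGate, Matrix.permMatrix_mulVec]

lemma moment_perm (σ : Equiv.Perm (Fin d)) (i j k l : Fin d) :
    moment (σ i) (σ j) (σ k) (σ l) = moment i j k l := by
  conv_rhs => rw [← moment_comp_act (permGate σ)]
  simp only [act_permGate]
  rfl

/-- The Hadamard gate on the coordinates `i` and `l`. -/
def hadamardMatrix (i l : Fin d) : Matrix (Fin d) (Fin d) ℂ :=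
  Matrix.of fun a b =>
    if a = i then (if b = i ∨ b = l then ((√2)⁻¹ : ℝ) else 0)
    else if a = l then (if b = i then ((√2)⁻¹ : ℝ) else if b = l then (-(√2)⁻¹ : ℝ) else 0)
    else if a = b then 1 else 0

lemma sum_eq_two {i l : Fin d} (h : i ≠ l) (f : Fin d → ℂ)
    (hf : ∀ b, b ≠ i → b ≠ l → f b = 0) : ∑ b, f b = f i + f l := by
  rw [← Finset.sum_pair h]
  symm
  refine Finset.sum_subset (Finset.subset_univ _) fun b _ hb => ?_
  simp only [Finset.mem_insert, Finset.mem_singleton, not_or] at hb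
  exact hf b hb.1 hb.2

lemma hadamard_mulVec {i l : Fin d} (h : i ≠ l) (v : Fin d → ℂ) (a : Fin d) :
    (hadamardMatrix i l).mulVec v a =
      if a = i then ((√2)⁻¹ : ℝ) * (v i + v l)
      else if a = l then ((√2)⁻¹ : ℝ) * (v i - v l) else v a := by
  simp only [Matrix.mulVec, dotProduct, hadamardMatrix, Matrix.of_apply]
  by_cases hai : a = i
  · simp only [hai, if_true]
    rw [sum_eq_two h _ fun b h1 h2 => by simp [h1, h2]]
    simp
    ring
  · by_cases hal : a = l
    · simp only [hal, h.symm, if_true, if_false]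
      rw [sum_eq_two h _ fun b h1 h2 => by simp [h1, h2]]
      simp [h.symm]
      ring
    · simp [hai, hal]

lemma inv_sqrt_two_mul_self : (((√2)⁻¹ : ℝ) : ℂ) * (((√2)⁻¹ : ℝ) : ℂ) = 1 / 2 := by
  rw [← Complex.ofReal_mul, ← mul_inv, Real.mul_self_sqrt (by norm_num)]
  norm_num

lemma hadamardMatrix_isHermitian (i l : Fin d) : (hadamardMatrix i l).conjTranspose =
    hadamardMatrix i l := by
  ext a b
  simp only [hadamardMatrix, Matrix.conjTranspose_apply, Matrix.of_apply, apply_ite star,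
    star_zero, star_one, Complex.star_def, Complex.conj_ofReal]
  grind

/-- The Hadamard gate on two coordinates, as a unitary. -/
def hadamardGate {i l : Fin d} (h : i ≠ l) : UGroup d :=
  ⟨hadamardMatrix i l, by
    rw [Matrix.mem_unitaryGroup_iff, Matrix.star_eq_conjTranspose, hadamardMatrix_isHermitian]
    refine Matrix.ext_of_mulVec_single fun b => ?_
    rw [← Matrix.mulVec_mulVec, Matrix.one_mulVec]
    ext a
    have := inv_sqrt_two_mul_self
    simp only [hadamard_mulVec h, h.symm, if_true, if_false]
    split_ifs with h1 h2
    · rw [h1]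
      linear_combination (2 * (Pi.single b 1 : Fin d → ℂ) i) * this
    · rw [h2]
      linear_combination (2 * (Pi.single b 1 : Fin d → ℂ) l) * this
    · rfl⟩

/-- The Hadamard gate sends `xᵢxₗ` to `(xᵢ² - xₗ²)/2`. Taking squared moduli and expectations, the
cross terms vanish by `moment_eq_zero`. -/
lemma moment_of_ne [NeZero d] {i l : Fin d} (h : i ≠ l) :
    moment i i l l = (moment i i i i + moment l l l l) / 4 := by
  have h1 : moment i l l i = 0 := by
    refine moment_eq_zero ?_
    simp [h]
  have h2 : moment l i i l = 0 := by
    refine moment_eq_zero ?_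
    simp [h.symm]
  have hi := fun a b c e => integrable_uniformState (continuous_moment_integrand (d := d) a b c e)
  have hs := inv_sqrt_two_mul_self
  rw [← moment_comp_act (hadamardGate h)]
  have : ∀ x : Metric.sphere (0 : HX d) 1,
      star (act (hadamardGate h).1 x.1 i) * act (hadamardGate h).1 x.1 i *
        act (hadamardGate h).1 x.1 l * star (act (hadamardGate h).1 x.1 l) =
      (1 / 4 : ℂ) * (star (x.1 i) * x.1 i * x.1 i * star (x.1 i)
        + star (x.1 l) * x.1 l * x.1 l * star (x.1 l)
        - star (x.1 i) * x.1 l * x.1 l * star (x.1 i)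
        - star (x.1 l) * x.1 i * x.1 i * star (x.1 l)) := by
    intro x
    simp only [act, hadamardGate, hadamard_mulVec h, h.symm, if_true, if_false, star_mul', star_add,
      star_sub]
    set s := (((√2)⁻¹ : ℝ) : ℂ)
    have hst : star s = s := Complex.conj_ofReal _
    rw [hst]
    have : s * s * (s * s) = 1 / 4 := by rw [hs]; norm_num
    rw [← this]
    ring
  simp_rw [this]
  rw [integral_const_mul, integral_sub, integral_sub, integral_add]
  · change (1 / 4 : ℂ) * (moment i i i i + moment l l l l - moment i l l i - moment l i i l) = _
    rw [h1, h2]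
    ring
  · exact hi _ _ _ _
  · exact hi _ _ _ _
  · exact (hi _ _ _ _).add (hi _ _ _ _)
  · exact hi _ _ _ _
  · exact ((hi _ _ _ _).add (hi _ _ _ _)).sub (hi _ _ _ _)
  · exact hi _ _ _ _

lemma moment_self_eq (i l : Fin d) : moment i i i i = moment l l l l := by
  rw [← moment_perm (Equiv.swap l i) l l l l]
  simp

lemma moment_swap (i j k l : Fin d) : moment i j k l = moment i k j l := by
  unfold moment
  congr 1
  ext x
  ring

/-- The diagonal moments agree by permutation invariance, and the paired ones with two distinct
indices are half of them. When all four indices coincide both indicators are 1, which accounts for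
the factor 2. -/
lemma moment_eq_mul [NeZero d] (i j k l : Fin d) :
    moment i j k l = moment (0 : Fin d) 0 0 0 / 2 *
      ((if i = j ∧ k = l then 1 else 0) + (if i = k ∧ j = l then 1 else 0)) := by
  have hne : ∀ i l : Fin d, i ≠ l → moment i i l l = moment (0 : Fin d) 0 0 0 / 2 := by
    intro i l h
    rw [moment_of_ne h, moment_self_eq i 0, moment_self_eq l 0]
    ring
  by_cases h1 : i = j ∧ k = l
  · obtain ⟨rfl, rfl⟩ := h1
    by_cases hik : i = k
    · subst hik
      rw [moment_self_eq i 0]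
      norm_num
    · simp [hik, hne i k hik]
  · by_cases h2 : i = k ∧ j = l
    · obtain ⟨rfl, rfl⟩ := h2
      have hij : i ≠ j := fun h => h1 ⟨h, h⟩
      rw [moment_swap, hne i j hij]
      simp [hij]
    · rw [moment_eq_zero (not_or.2 ⟨h1, h2⟩)]
      simp [h1, h2]

lemma sum_norm_sq_sphere (x : Metric.sphere (0 : HX d) 1) :
    ∑ i, star (x.1 i) * x.1 i = (1 : ℂ) := by
  have h : ‖x.1‖ = 1 := by simp
  have h2 := inner_self_eq_norm_sq_to_K (𝕜 := ℂ) x.1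
  rw [h, EuclideanSpace.inner_eq_star_dotProduct, dotProduct_comm] at h2
  simpa [dotProduct] using h2

/-- Normalization: integrating `(∑ |xᵢ|²)² = 1` gives `C (d² + d) = 1` for the common constant `C`.
-/
lemma moment_zero [NeZero d] : moment (0 : Fin d) 0 0 0 / 2 = 1 / (d * (d + 1)) := by
  have h1 : ∑ i : Fin d, ∑ l : Fin d, moment i i l l = 1 := by
    have : ∀ x : Metric.sphere (0 : HX d) 1, ∑ i, ∑ l,
        star (x.1 i) * x.1 i * x.1 l * star (x.1 l) = (1 : ℂ) := by
      intro x
      rw [← mul_one (1 : ℂ)]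
      conv_rhs => rw [← sum_norm_sq_sphere x, Finset.sum_mul_sum]
      refine Finset.sum_congr rfl fun i _ => Finset.sum_congr rfl fun l _ => ?_
      ring
    have hi := fun a b c e =>
      integrable_uniformState (continuous_moment_integrand (d := d) a b c e)
    simp only [moment]
    simp_rw [← integral_finsetSum Finset.univ fun l _ => hi _ _ l l]
    rw [← integral_finsetSum Finset.univ fun i _ =>
      integrable_finsetSum Finset.univ fun l _ => hi i i l l]
    simp_rw [this]
    simp
  have hd : (d : ℂ) ≠ 0 := NeZero.ne _
  have hd1 : (d : ℂ) + 1 ≠ 0 := by exact_mod_cast Nat.succ_ne_zero d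
  have hC := moment_eq_mul (d := d)
  generalize moment (0 : Fin d) 0 0 0 / 2 = C at hC ⊢
  simp_rw [hC] at h1
  simp only [and_self, if_true, ← Finset.mul_sum, Finset.sum_add_distrib, Finset.sum_const,
    Finset.card_univ, Fintype.card_fin, nsmul_eq_mul, mul_one, Finset.sum_ite_eq,
    Finset.mem_univ] at h1
  rw [eq_div_iff (mul_ne_zero hd hd1)]
  linear_combination h1

/-- The second moment of the expectation of a matrix in a uniformly random pure state. -/
theorem integral_norm_sq_inner_act [NeZero d] (A : Matrix (Fin d) (Fin d) ℂ) :
    ∫ x : Metric.sphere (0 : HX d) 1, ‖inner ℂ x.1 (act A x.1)‖ ^ 2 ∂(uniformState d) =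
      (‖A.trace‖ ^ 2 + ∑ i, ∑ j, ‖A i j‖ ^ 2) / (d * (d + 1)) := by
  have hpt : ∀ x : Metric.sphere (0 : HX d) 1, ((‖inner ℂ x.1 (act A x.1)‖ ^ 2 : ℝ) : ℂ) =
      ∑ i, ∑ j, ∑ l, ∑ k, (A i j * star (A l k)) *
        (star (x.1 i) * x.1 j * x.1 l * star (x.1 k)) := by
    intro x
    have hx : inner ℂ x.1 (act A x.1) = ∑ i, ∑ j, A i j * (star (x.1 i) * x.1 j) := by
      simp only [EuclideanSpace.inner_eq_star_dotProduct, act, dotProduct, Matrix.mulVec,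
        Finset.sum_mul, Pi.star_apply]
      refine Finset.sum_congr rfl fun i _ => Finset.sum_congr rfl fun l _ => ?_
      ring
    rw [← Complex.normSq_eq_norm_sq, ← Complex.mul_conj, hx, Finset.sum_mul]
    refine Finset.sum_congr rfl fun i _ => ?_
    rw [Finset.sum_mul]
    refine Finset.sum_congr rfl fun j _ => ?_
    rw [map_sum, Finset.mul_sum]
    refine Finset.sum_congr rfl fun l _ => ?_
    rw [map_sum, Finset.mul_sum]
    refine Finset.sum_congr rfl fun k _ => ?_
    simp only [map_mul, ← Complex.star_def, star_star]
    ring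
  have hi := fun a b c e =>
    (integrable_uniformState (continuous_moment_integrand (d := d) a b c e)).const_mul
      (A a b * star (A c e))
  apply Complex.ofReal_injective
  rw [← integral_complex_ofReal]
  simp_rw [hpt]
  rw [integral_finsetSum _ fun i _ => integrable_finsetSum _ fun j _ =>
    integrable_finsetSum _ fun l _ => integrable_finsetSum _ fun k _ => hi i j l k]
  simp_rw [integral_finsetSum Finset.univ fun j _ =>
    integrable_finsetSum _ fun l _ => integrable_finsetSum _ fun k _ => hi _ j l k]
  simp_rw [integral_finsetSum Finset.univ fun l _ =>
    integrable_finsetSum _ fun k _ => hi _ _ l k]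
  simp_rw [integral_finsetSum Finset.univ fun k _ => hi _ _ _ k]
  simp_rw [integral_const_mul]
  change ∑ i, ∑ j, ∑ l, ∑ k, A i j * star (A l k) * moment i j l k = _
  have hC := moment_eq_mul (d := d)
  rw [moment_zero] at hC
  simp_rw [hC]
  -- The two index pairings of `moment_eq_mul` produce the squared trace and the squared Frobenius
  -- norm.
  have h1 : ∑ i, ∑ j, ∑ l, ∑ k, (A i j * star (A l k)) * (if i = j ∧ l = k then (1 : ℂ) else 0)
      = ((‖A.trace‖ ^ 2 : ℝ) : ℂ) := by
    rw [← Complex.normSq_eq_norm_sq, ← Complex.mul_conj]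
    simp only [ite_and, mul_ite, mul_one, mul_zero, Finset.sum_ite_irrel, Finset.sum_const_zero,
      Finset.sum_ite_eq, Finset.mem_univ, if_true, Matrix.trace, Matrix.diag_apply, map_sum,
      Finset.sum_mul_sum]
    rfl
  have h2 : ∑ i, ∑ j, ∑ l, ∑ k, (A i j * star (A l k)) * (if i = l ∧ j = k then (1 : ℂ) else 0)
      = ((∑ i, ∑ j, ‖A i j‖ ^ 2 : ℝ) : ℂ) := by
    push_cast
    refine Finset.sum_congr rfl fun i _ => Finset.sum_congr rfl fun j _ => ?_
    rw [← Complex.ofReal_pow, ← Complex.normSq_eq_norm_sq, ← Complex.mul_conj]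
    simp only [ite_and, mul_ite, mul_one, mul_zero, Finset.sum_ite_irrel, Finset.sum_const_zero,
      Finset.sum_ite_eq, Finset.mem_univ, if_true]
    rfl
  rw [Complex.ofReal_div, Complex.ofReal_add, ← h1, ← h2]
  simp only [← Finset.sum_add_distrib, Finset.sum_div]
  refine Finset.sum_congr rfl fun i _ => Finset.sum_congr rfl fun j _ =>
    Finset.sum_congr rfl fun l _ => Finset.sum_congr rfl fun k _ => ?_
  push_cast
  ring

end Moments

/-- The risk in terms of the trace of `U† V`. -/
theorem risk_eq {d : ℕ} [NeZero d] (U V : UGroup d) :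
    risk U V = 1 - (‖(star U.1 * V.1).trace‖ ^ 2 + d) / (d * (d + 1)) := by
  have hW : star U.1 * V.1 ∈ Matrix.unitaryGroup (Fin d) ℂ := (star U * V).2
  have hfro : ∑ i, ∑ j, ‖(star U.1 * V.1) i j‖ ^ 2 = (d : ℝ) := by
    have h : ∀ i, ∑ j, ‖(star U.1 * V.1) i j‖ ^ 2 = (1 : ℝ) := by
      intro i
      have := congrFun (congrFun (Matrix.mem_unitaryGroup_iff.1 hW) i) i
      rw [Matrix.mul_apply, Matrix.one_apply_eq] at this
      apply Complex.ofReal_injective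
      push_cast
      rw [← this]
      refine Finset.sum_congr rfl fun j _ => ?_
      rw [← Complex.ofReal_pow, ← Complex.normSq_eq_norm_sq, ← Complex.mul_conj]
      rfl
    simp [h]
  have hpt : ∀ x : Metric.sphere (0 : HX d) 1,
      traceDist (density (act U.1 x.1)) (density (act V.1 x.1)) ^ 2 =
        1 - ‖inner ℂ x.1 (act (star U.1 * V.1) x.1)‖ ^ 2 := by
    intro x
    rw [traceDist_density_sq (by simp [norm_act]) (by simp [norm_act]), inner_act_act,
      Matrix.star_eq_conjTranspose]
  rw [risk]
  simp_rw [hpt]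
  rw [integral_sub (integrable_const _), integral_norm_sq_inner_act, hfro]
  · simp
  · refine Continuous.integrable_of_hasCompactSupport ?_ (HasCompactSupport.of_compactSpace _)
    have : Continuous fun x : Metric.sphere (0 : HX d) 1 => act (star U.1 * V.1) x.1 :=
      (unitaryIsometry (star U * V)).continuous.comp continuous_subtype_val
    fun_prop

/-! ### A finite twirl over the unitaries that fix a given orthonormal family -/

section Twirl

/-- Averaging over independent signs kills the cross terms. In the induction, the two signs of the
new index combine by the parallelogram law. -/
lemma sum_powerset_norm_sq_add_signed_sum {J : Type*} [DecidableEq J] (z : J → ℂ) (s : Finset J)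
    (c : ℂ) :
    ∑ ε ∈ s.powerset, ‖c + ∑ j ∈ s, (if j ∈ ε then (1 : ℂ) else -1) * z j‖ ^ 2 =
      2 ^ s.card * (‖c‖ ^ 2 + ∑ j ∈ s, ‖z j‖ ^ 2) := by
  induction s using Finset.induction_on generalizing c with
  | empty => simp
  | insert a s ha ih =>
    rw [Finset.sum_powerset_insert ha]
    have h1 : ∑ ε ∈ s.powerset,
        ‖c + ∑ j ∈ insert a s, (if j ∈ ε then (1 : ℂ) else -1) * z j‖ ^ 2 =
        ∑ ε ∈ s.powerset, ‖(c - z a) + ∑ j ∈ s, (if j ∈ ε then (1 : ℂ) else -1) * z j‖ ^ 2 := by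
      refine Finset.sum_congr rfl fun ε hε => ?_
      have : a ∉ ε := fun h => ha (Finset.mem_powerset.1 hε h)
      rw [Finset.sum_insert ha, if_neg this, ← add_assoc]
      congr 3
      ring
    have h2 : ∑ ε ∈ s.powerset,
        ‖c + ∑ j ∈ insert a s, (if j ∈ insert a ε then (1 : ℂ) else -1) * z j‖ ^ 2 =
        ∑ ε ∈ s.powerset, ‖(c + z a) + ∑ j ∈ s, (if j ∈ ε then (1 : ℂ) else -1) * z j‖ ^ 2 := by
      refine Finset.sum_congr rfl fun ε hε => ?_
      rw [Finset.sum_insert ha, if_pos (Finset.mem_insert_self a ε), ← add_assoc, one_mul]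
      congr 3
      refine Finset.sum_congr rfl fun j hj => ?_
      have : j ≠ a := fun h => ha (h ▸ hj)
      simp [this]
    rw [h1, h2, ih, ih, Finset.card_insert_of_notMem ha, Finset.sum_insert ha, pow_succ]
    have := parallelogram_law_with_norm ℝ c (z a)
    linear_combination (2 : ℝ) ^ s.card * this

/-- Under the cyclic shifts `j ↦ j + g`, each `j` reaches every row exactly once, so the double sum
is a sum of `s` full column sums. Writing the number of permutations as `n + 1` keeps the index set
nonempty also for `s = 0`, where the identity alone is used. -/
lemma exists_transitive_perms (s : ℕ) : ∃ (n : ℕ) (ρ : Fin (n + 1) → Equiv.Perm (Fin s)),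
    ∀ y : Fin s → Fin s → ℝ, (∀ j, ∑ i, y i j ≤ 1) → ∑ g, ∑ j, y (ρ g j) j ≤ n + 1 := by
  rcases s with _ | s
  · exact ⟨0, fun _ => 1, fun y _ => by simp⟩
  · refine ⟨s, fun g => Equiv.addRight g, fun y hy => ?_⟩
    rw [Finset.sum_comm]
    calc ∑ j, ∑ g, y (j + g) j = ∑ j, ∑ i, y i j :=
          Finset.sum_congr rfl fun j _ => Equiv.sum_comp (Equiv.addLeft j) fun i => y i j
      _ ≤ ∑ _j : Fin (s + 1), (1 : ℝ) := Finset.sum_le_sum fun j _ => hy j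
      _ = s + 1 := by simp

lemma trace_eq_sum_inner_act {d : ℕ} {ι : Type*} [Fintype ι]
    (b : OrthonormalBasis ι ℂ (HX d)) (A : Matrix (Fin d) (Fin d) ℂ) :
    A.trace = ∑ i, inner ℂ (b i) (act A (b i)) := by
  have h := LinearMap.trace_eq_sum_inner (Matrix.toLpLin 2 2 A) b
  rw [Matrix.toLpLin_eq_toLin, Matrix.trace_toLin_eq] at h
  exact h

lemma exists_orthonormalBasis_eq {d : ℕ} {ι : Type*} [Fintype ι] (hι : Fintype.card ι = d)
    {v : ι → HX d} (hv : Orthonormal ℂ v) : ∃ b : OrthonormalBasis ι ℂ (HX d), ∀ i, b i = v i := by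
  have : Orthonormal ℂ ((Set.univ : Set ι).domRestrict v) :=
    hv.comp Subtype.val Subtype.val_injective
  obtain ⟨b, hb⟩ := this.exists_orthonormalBasis_extension_of_card_eq (by simp [hι])
  exact ⟨b, fun i => hb i trivial⟩

lemma exists_unitary_act_eq {d : ℕ} {ι : Type*} [Fintype ι]
    (b b' : OrthonormalBasis ι ℂ (HX d)) : ∃ T : UGroup d, ∀ i, act T.1 (b i) = b' i := by
  let f : HX d ≃ₗᵢ[ℂ] HX d := b.equiv b' (Equiv.refl ι)
  let u : unitary (HX d →L[ℂ] HX d) := Unitary.linearIsometryEquiv.symm f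
  refine ⟨⟨(Matrix.toEuclideanCLM (n := Fin d) (𝕜 := ℂ)).symm u.1, ?_⟩, fun i => ?_⟩
  · exact Unitary.map_mem (Matrix.toEuclideanCLM (n := Fin d) (𝕜 := ℂ)).symm u.2
  · have h : ∀ x, act ((Matrix.toEuclideanCLM (n := Fin d) (𝕜 := ℂ)).symm u.1) x = u.1 x := by
      intro x
      conv_rhs => rw [← (Matrix.toEuclideanCLM (n := Fin d) (𝕜 := ℂ)).apply_symm_apply u.1]
      rfl
    rw [h]
    change f (b i) = b' i
    simp [f]

/-- A finite replacement for the Haar average over the unitaries fixing `e`: each `T a` is the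
identity on `e` and a signed cyclic shift on a basis of the complement. The signs decouple the
entries of the complementary block of `W`, and the shifts average its squared entries to at most 1.
The family `T` is chosen before `W`, since `W` will vary with the target. -/
theorem exists_twirl {d : ℕ} {κ : Type*} [Fintype κ] {e : κ → HX d} (he : Orthonormal ℂ e) :
    ∃ (A : Type) (_ : Fintype A) (_ : Nonempty A) (T : A → UGroup d),
      (∀ a k, act (T a).1 (e k) = e k) ∧
      ∀ (W : UGroup d) (c : κ → ℂ), (∀ k, act W.1 (e k) = c k • e k) →
        ∑ a, ‖(star (T a).1 * W.1).trace‖ ^ 2 ≤ Fintype.card A * (‖∑ k, c k‖ ^ 2 + 1) := by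
  classical
  have hcard : Fintype.card κ ≤ d := by
    simpa using he.linearIndependent.fintype_card_le_finrank
  obtain ⟨s, hs⟩ := Nat.exists_eq_add_of_le hcard
  obtain ⟨b, hb⟩ : ∃ b : OrthonormalBasis (κ ⊕ Fin s) ℂ (HX d), ∀ k, b (Sum.inl k) = e k := by
    have : Orthonormal ℂ ((Set.range (Sum.inl : κ → κ ⊕ Fin s)).domRestrict
        (Sum.elim e fun _ => 0)) := by
      have h := he.comp (Equiv.ofInjective _ (Sum.inl_injective (α := κ) (β := Fin s))).symm
        (Equiv.injective _)
      convert h using 1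
      ext1 ⟨x, k, hk⟩
      subst hk
      simp
    obtain ⟨b, hb⟩ := this.exists_orthonormalBasis_extension_of_card_eq (by simp [hs])
    exact ⟨b, fun k => by simpa using hb (Sum.inl k) ⟨k, rfl⟩⟩
  obtain ⟨n, ρ, hρ⟩ := exists_transitive_perms s
  let sgn : Finset (Fin s) → Fin s → ℂ := fun ε j => if j ∈ ε then 1 else -1
  have hsgn : ∀ ε j, star (sgn ε j) = sgn ε j := fun ε j => by
    simp only [sgn]; split_ifs <;> simp
  have hT : ∀ a : Finset (Fin s) × Fin (n + 1), ∃ T : UGroup d,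
      (∀ k, act T.1 (e k) = e k) ∧
        ∀ j, act T.1 (b (Sum.inr j)) = sgn a.1 j • b (Sum.inr (ρ a.2 j)) := by
    intro a
    let v : κ ⊕ Fin s → HX d := Sum.elim e fun j => sgn a.1 j • b (Sum.inr (ρ a.2 j))
    have hv : Orthonormal ℂ v := by
      have h1 := (b.orthonormal.comp (Equiv.sumCongr (Equiv.refl κ) (ρ a.2))
        (Equiv.injective _))
      rw [orthonormal_iff_ite] at h1 ⊢
      rintro (i | i) (j | j)
      · simpa [v, hb] using h1 (Sum.inl i) (Sum.inl j)
      · have := h1 (Sum.inl i) (Sum.inr j)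
        simp only [Function.comp, Equiv.sumCongr_apply, Sum.map_inl, Sum.map_inr, hb,
          Equiv.refl_apply] at this
        simp [v, inner_smul_right, this]
      · have := h1 (Sum.inr i) (Sum.inl j)
        simp only [Function.comp, Equiv.sumCongr_apply, Sum.map_inl, Sum.map_inr, hb,
          Equiv.refl_apply] at this
        simp [v, inner_smul_left, this]
      · have := h1 (Sum.inr i) (Sum.inr j)
        simp only [Function.comp, Equiv.sumCongr_apply, Sum.map_inr, Sum.inr.injEq] at this
        simp only [v, Sum.elim_inr, inner_smul_left, inner_smul_right, this, Sum.inr.injEq]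
        by_cases hij : i = j
        · subst hij
          simp only [sgn]
          split_ifs <;> simp
        · simp [hij]
    obtain ⟨b', hb'⟩ := exists_orthonormalBasis_eq (by simp [hs]) hv
    obtain ⟨T, hT⟩ := exists_unitary_act_eq b b'
    refine ⟨T, fun k => ?_, fun j => ?_⟩
    · rw [← hb, hT, hb', hb]; rfl
    · rw [hT, hb']; rfl
  choose T hTe hTb using hT
  refine ⟨Finset (Fin s) × Fin (n + 1), inferInstance, inferInstance, T, hTe, fun W c hc => ?_⟩
  let y : Fin s → Fin s → ℂ := fun i j => inner ℂ (b (Sum.inr i)) (act W.1 (b (Sum.inr j)))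
  have htr : ∀ a, (star (T a).1 * W.1).trace =
      ∑ k, c k + ∑ j ∈ Finset.univ, (if j ∈ a.1 then (1 : ℂ) else -1) * y (ρ a.2 j) j := by
    intro a
    rw [trace_eq_sum_inner_act b, Fintype.sum_sum_type]
    congr 1
    · refine Finset.sum_congr rfl fun k _ => ?_
      rw [Matrix.star_eq_conjTranspose, ← inner_act_act, hb, hTe, hc, inner_smul_right,
        inner_self_eq_norm_sq_to_K, he.1 k]
      simp
    · refine Finset.sum_congr rfl fun j _ => ?_
      rw [Matrix.star_eq_conjTranspose, ← inner_act_act, hTb, inner_smul_left,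
        ← Complex.star_def, hsgn]
  -- Bessel's inequality: a column of the compressed unitary is part of a unit vector.
  have hy : ∀ j, ∑ i, ‖y i j‖ ^ 2 ≤ 1 := by
    intro j
    have h := (b.orthonormal.comp Sum.inr Sum.inr_injective).sum_inner_products_le
      (act W.1 (b (Sum.inr j))) (s := Finset.univ)
    rwa [norm_act, b.orthonormal.1, one_pow] at h
  simp_rw [htr]
  rw [Fintype.sum_prod_type, Finset.sum_comm]
  have hg : ∀ g : Fin (n + 1), ∑ ε : Finset (Fin s),
      ‖∑ k, c k + ∑ j, (if j ∈ ε then (1 : ℂ) else -1) * y (ρ g j) j‖ ^ 2 =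
        2 ^ s * (‖∑ k, c k‖ ^ 2 + ∑ j, ‖y (ρ g j) j‖ ^ 2) := by
    intro g
    have := sum_powerset_norm_sq_add_signed_sum (fun j => y (ρ g j) j) Finset.univ (∑ k, c k)
    rwa [Finset.powerset_univ, Finset.card_univ, Fintype.card_fin] at this
  simp only [hg]
  rw [← Finset.mul_sum, Finset.sum_add_distrib]
  have := hρ (fun i j => ‖y i j‖ ^ 2) hy
  simp only [Finset.sum_const, Finset.card_univ, Fintype.card_fin, nsmul_eq_mul, Fintype.card_prod,
    Fintype.card_finset]
  push_cast
  rw [mul_assoc]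
  refine mul_le_mul_of_nonneg_left ?_ (by positivity)
  linarith

end Twirl

/-! ### Consequences of perfect training -/

section PerfectTraining

variable {d m : ℕ}

lemma actX_apply (A : Matrix (Fin d) (Fin d) ℂ) (ψ : HXR d m) (a : Fin d) (b : Fin m) :
    actX A ψ (a, b) = ∑ a', A a a' * ψ (a', b) := by
  simp only [actX, act, Matrix.mulVec, dotProduct, Matrix.kroneckerMap_apply,
    Fintype.sum_prod_type, Matrix.one_apply]
  simp

lemma actX_mul (A B : Matrix (Fin d) (Fin d) ℂ) (ψ : HXR d m) :
    actX (A * B) ψ = actX A (actX B ψ) := by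
  rw [actX, actX, actX, ← act_mul, ← Matrix.mul_kronecker_mul, one_mul]

lemma norm_actX (U : UGroup d) (ψ : HXR d m) : ‖actX U.1 ψ‖ = ‖ψ‖ := by
  have h : inner ℂ (actX U.1 ψ) (actX U.1 ψ) = inner ℂ ψ ψ := by
    rw [actX, inner_act_act, Matrix.conjTranspose_kronecker, ← Matrix.mul_kronecker_mul,
      ← Matrix.star_eq_conjTranspose, Unitary.star_mul_self_of_mem U.2]
    simp [act]
  rw [inner_self_eq_norm_sq_to_K, inner_self_eq_norm_sq_to_K] at h
  have h' : ‖actX U.1 ψ‖ ^ 2 = ‖ψ‖ ^ 2 := by exact_mod_cast h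
  exact (sq_eq_sq₀ (norm_nonneg _) (norm_nonneg _)).1 h'

lemma norm_overlap_le (U V : UGroup d) {ψ : HXR d m} (hψ : ‖ψ‖ = 1) : ‖overlap U V ψ‖ ≤ 1 := by
  have h := norm_inner_le_norm (𝕜 := ℂ) ψ (actX (star U * V).1 ψ)
  rwa [norm_actX, hψ, mul_one] at h

/-- The loss is the mean of the nonnegative numbers `1 - |overlap|²`, so each of them vanishes. -/
lemma norm_overlap_eq_one {t : ℕ} (ht : 1 ≤ t) {U V : UGroup d} {S : Fin t → HXR d m}
    (hS : Orthonormal ℂ S) (h : loss U V S = 0) (j : Fin t) : ‖overlap U V (S j)‖ = 1 := by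
  have ht' : (t : ℝ) ≠ 0 := by positivity
  have hsum : ∑ j, (1 - ‖overlap U V (S j)‖ ^ 2) = 0 := by
    rw [loss] at h
    field_simp at h
    rw [Finset.sum_sub_distrib]
    simpa using h
  have hle : ∀ j, ‖overlap U V (S j)‖ ≤ 1 := fun j => norm_overlap_le U V (hS.1 j)
  have hz := (Finset.sum_eq_zero_iff_of_nonneg fun j _ =>
    sub_nonneg.2 (pow_le_one₀ (norm_nonneg _) (hle j))).1 hsum j (Finset.mem_univ j)
  have h1 : ‖overlap U V (S j)‖ ^ 2 = 1 := by linarith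
  exact (pow_eq_one_iff_of_nonneg (norm_nonneg _) two_ne_zero).1 h1

/-- Equality in Cauchy–Schwarz: with `z` the overlap, the squared distance of the two sides is `1 -
2|z|² + |z|² = 0`. -/
lemma actX_eq_overlap_smul {U V : UGroup d} {ψ : HXR d m} (hψ : ‖ψ‖ = 1)
    (h : ‖overlap U V ψ‖ = 1) : actX (star U.1 * V.1) ψ = overlap U V ψ • ψ := by
  have h1 : ‖actX (star U.1 * V.1) ψ‖ = 1 := by
    rw [← hψ]
    exact norm_actX (star U * V) ψ
  rw [← sub_eq_zero, ← norm_eq_zero, ← sq_eq_zero_iff, @norm_sub_sq ℂ, norm_smul, h1, h, hψ,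
    inner_smul_right, ← inner_conj_symm]
  change 1 ^ 2 - 2 * RCLike.re (overlap U V ψ * starRingEnd ℂ (overlap U V ψ)) + (1 * 1) ^ 2 = 0
  rw [Complex.mul_conj, Complex.normSq_eq_norm_sq, h]
  norm_num

/-- `ξ` is the family of the Schmidt vectors in `H_X` of `ψ`. -/
def IsSchmidtFamily {r : ℕ} (ψ : HXR d m) (ξ : Fin r → HX d) : Prop :=
  ∃ (c : Fin r → ℝ) (ζ : Fin r → EuclideanSpace ℂ (Fin m)),
    (∀ k, 0 < c k) ∧ Orthonormal ℂ ζ ∧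
    ∀ a b, ψ (a, b) = ∑ k, (Real.sqrt (c k) : ℂ) * (ξ k a * ζ k b)

lemma actX_apply_of_schmidt {r : ℕ} {ψ : HXR d m} {ξ : Fin r → HX d} {c : Fin r → ℝ}
    {ζ : Fin r → EuclideanSpace ℂ (Fin m)}
    (h : ∀ a b, ψ (a, b) = ∑ k, (Real.sqrt (c k) : ℂ) * (ξ k a * ζ k b))
    (A : Matrix (Fin d) (Fin d) ℂ) (a : Fin d) (b : Fin m) :
    actX A ψ (a, b) = ∑ k, (Real.sqrt (c k) : ℂ) * (act A (ξ k) a * ζ k b) := by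
  rw [actX_apply]
  simp only [h, act, Matrix.mulVec, dotProduct, Finset.mul_sum, Finset.sum_mul]
  rw [Finset.sum_comm]
  refine Finset.sum_congr rfl fun k _ => Finset.sum_congr rfl fun a' _ => ?_
  ring

lemma IsSchmidtFamily.actX_eq_self {r : ℕ} {ψ : HXR d m} {ξ : Fin r → HX d}
    (h : IsSchmidtFamily ψ ξ) {A : Matrix (Fin d) (Fin d) ℂ} (hA : ∀ k, act A (ξ k) = ξ k) :
    actX A ψ = ψ := by
  obtain ⟨c, ζ, -, -, hψ⟩ := h
  ext ⟨a, b⟩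
  rw [actX_apply_of_schmidt hψ, hψ]
  simp only [hA]

/-- Pairing the second tensor factor with `ζ k` isolates the `k`-th summand of both sides, and its
coefficient `√cₖ` is nonzero. -/
lemma IsSchmidtFamily.act_eq_smul {r : ℕ} {ψ : HXR d m} {ξ : Fin r → HX d}
    (h : IsSchmidtFamily ψ ξ) {A : Matrix (Fin d) (Fin d) ℂ} {z : ℂ} (hA : actX A ψ = z • ψ)
    (k : Fin r) : act A (ξ k) = z • ξ k := by
  obtain ⟨c, ζ, hc, hζ, hψ⟩ := h
  have hdual : ∀ (f : Fin r → ℂ), ∑ b, (∑ l, f l * ζ l b) * star (ζ k b) = f k := by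
    intro f
    have hin : ∀ l, ∑ b, ζ l b * star (ζ k b) = if k = l then 1 else 0 := by
      intro l
      rw [← (orthonormal_iff_ite.1 hζ) k l, EuclideanSpace.inner_eq_star_dotProduct]
      rfl
    simp only [Finset.sum_mul]
    rw [Finset.sum_comm]
    simp only [mul_assoc, ← Finset.mul_sum, hin]
    simp
  ext a
  have h1 : ∀ b, ∑ l, (Real.sqrt (c l) * act A (ξ l) a : ℂ) * ζ l b =
      ∑ l, (Real.sqrt (c l) * (z * ξ l a) : ℂ) * ζ l b := by
    intro b
    have := congrArg (fun v : HXR d m => v (a, b)) hA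
    simp only [PiLp.smul_apply, smul_eq_mul, hψ, actX_apply_of_schmidt hψ, Finset.mul_sum] at this
    convert this using 2 <;> ring
  have h2 := hdual fun l => (Real.sqrt (c l) * act A (ξ l) a : ℂ)
  simp only [h1] at h2
  rw [hdual fun l => (Real.sqrt (c l) * (z * ξ l a) : ℂ)] at h2
  have hk : (Real.sqrt (c k) : ℂ) ≠ 0 := by exact_mod_cast (Real.sqrt_pos.2 (hc k)).ne'
  rw [PiLp.smul_apply, smul_eq_mul]
  exact (mul_left_cancel₀ hk h2).symm

lemma inner_eq_zero_of_act_eq_smul (W : UGroup d) {u v : HX d} {z w : ℂ}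
    (hu : act W.1 u = z • u) (hv : act W.1 v = w • v) (hz : ‖z‖ = 1) (hzw : z ≠ w) :
    inner ℂ u v = 0 := by
  have h : inner ℂ (act W.1 u) (act W.1 v) = inner ℂ u v := by
    rw [inner_act_act, ← Matrix.star_eq_conjTranspose, Unitary.star_mul_self_of_mem W.2, act_one]
  rw [hu, hv, inner_smul_left, inner_smul_right] at h
  have hzz : z * starRingEnd ℂ z = 1 := by
    rw [Complex.mul_conj, Complex.normSq_eq_norm_sq, hz]
    norm_num
  have h2 : (w - z) * inner ℂ u v = 0 := by
    linear_combination z * h - w * inner ℂ u v * hzz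
  exact (mul_eq_zero.1 h2).resolve_left (sub_ne_zero.2 hzw.symm)

lemma overlap_eq_exp_phase {U V : UGroup d} {ψ : HXR d m} (h : ‖overlap U V ψ‖ = 1) :
    overlap U V ψ = Complex.exp (phase U V ψ * Complex.I) := by
  have := Complex.norm_mul_exp_arg_mul_I (overlap U V ψ)
  rw [h, Complex.ofReal_one, one_mul] at this
  exact this.symm

end PerfectTraining

/-! ### Independent uniform phases -/

section Phases

variable {Ω : Type*} [MeasurableSpace Ω] {ν : Measure Ω}

lemma integral_exp_mul_I_of_isUniform {X : Ω → ℝ} (hX : AEMeasurable X ν)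
    (hu : pdf.IsUniform X (Set.Ioc (-Real.pi) Real.pi) ν volume) :
    ∫ p, Complex.exp (X p * Complex.I) ∂ν = 0 := by
  have hm : Continuous fun x : ℝ => Complex.exp (x * Complex.I) := by fun_prop
  rw [← integral_map (f := fun x : ℝ => Complex.exp (x * Complex.I)) hX hm.aestronglyMeasurable,
    hu, ProbabilityTheory.cond, integral_smul_measure,
    ← intervalIntegral.integral_of_le (by linarith [Real.pi_pos])]
  have h : ∫ x in (-Real.pi)..Real.pi, Complex.exp (x * Complex.I) = 0 := by
    simp_rw [mul_comm _ Complex.I]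
    rw [integral_exp_mul_complex Complex.I_ne_zero]
    have : Complex.exp (Complex.I * ((-Real.pi : ℝ) : ℂ)) = -1 := by
      rw [mul_comm, Complex.ofReal_neg, neg_mul, Complex.exp_neg_pi_mul_I]
    rw [this, mul_comm, Complex.exp_pi_mul_I, sub_self, zero_div]
  rw [h, smul_zero]

/-- By independence the joint law is a product, and the diagonal is null for it because the law of
`Y` has no atoms. -/
lemma ae_ne_of_indepFun_isUniform [IsProbabilityMeasure ν] {X Y : Ω → ℝ} (hX : AEMeasurable X ν)
    (hY : AEMeasurable Y ν) (hind : IndepFun X Y ν)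
    (hu : pdf.IsUniform Y (Set.Ioc (-Real.pi) Real.pi) ν volume) : ∀ᵐ p ∂ν, X p ≠ Y p := by
  have := Measure.isProbabilityMeasure_map hX
  have := Measure.isProbabilityMeasure_map hY
  have hdiag : (ν.map fun p => (X p, Y p)) (Set.diagonal ℝ) = 0 := by
    rw [(indepFun_iff_map_prod_eq_prod_map_map hX hY).1 hind,
      Measure.measure_prod_null measurableSet_diagonal]
    refine Filter.Eventually.of_forall fun x => ?_
    have : Prod.mk x ⁻¹' Set.diagonal ℝ = {x} := by
      ext y
      simp [eq_comm]
    change ν.map Y (Prod.mk x ⁻¹' Set.diagonal ℝ) = 0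
    rw [this, show ν.map Y = _ from hu, ProbabilityTheory.cond]
    simp
  rw [Measure.map_apply_of_aemeasurable (hX.prodMk hY) measurableSet_diagonal] at hdiag
  rw [ae_iff]
  refine measure_mono_null (fun p hp => ?_) hdiag
  simpa using hp

/-- Expand the square: the off-diagonal expectations factor by independence and contain a vanishing
mean; the diagonal ones are `cⱼ²`. -/
theorem integral_norm_sq_sum_exp [IsProbabilityMeasure ν] {ι : Type*} [Fintype ι] (c : ι → ℝ)
    {X : ι → Ω → ℝ} (hX : ∀ j, Measurable (X j)) (hind : iIndepFun X ν)
    (hu : ∀ j, pdf.IsUniform (X j) (Set.Ioc (-Real.pi) Real.pi) ν volume) :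
    ∫ p, ‖∑ j, (c j : ℂ) * Complex.exp (X j p * Complex.I)‖ ^ 2 ∂ν = ∑ j, c j ^ 2 := by
  classical
  let φ : ℝ → ℂ := fun x => Complex.exp (x * Complex.I)
  have hφ : Measurable φ := by fun_prop
  have hφ1 : ∀ x, ‖φ x‖ = 1 := fun x => Complex.norm_exp_ofReal_mul_I x
  have hpt : ∀ p, ((‖∑ j, (c j : ℂ) * Complex.exp (X j p * Complex.I)‖ ^ 2 : ℝ) : ℂ) =
      ∑ j, ∑ k, (c j * c k : ℂ) * (φ (X j p) * star (φ (X k p))) := by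
    intro p
    rw [← Complex.normSq_eq_norm_sq, ← Complex.mul_conj, map_sum, Finset.sum_mul_sum]
    refine Finset.sum_congr rfl fun j _ => Finset.sum_congr rfl fun k _ => ?_
    rw [map_mul, Complex.conj_ofReal, ← Complex.star_def]
    ring
  have hint : ∀ j k, Integrable (fun p => (c j * c k : ℂ) * (φ (X j p) * star (φ (X k p)))) ν := by
    intro j k
    refine Integrable.const_mul ?_ _
    refine Integrable.of_bound (C := 1) ?_ (Filter.Eventually.of_forall fun p => ?_)
    · exact ((hφ.comp (hX j)).mul
        (continuous_star.measurable.comp (hφ.comp (hX k)))).aestronglyMeasurable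
    · simp [hφ1]
  have hjk : ∀ j k, ∫ p, φ (X j p) * star (φ (X k p)) ∂ν = if j = k then 1 else 0 := by
    intro j k
    by_cases h : j = k
    · subst h
      have : ∀ p, φ (X j p) * star (φ (X j p)) = 1 := fun p => by
        rw [Complex.star_def, Complex.mul_conj, Complex.normSq_eq_norm_sq, hφ1]
        norm_num
      simp_rw [this]
      simp
    · have hi : IndepFun (φ ∘ X j) ((star ∘ φ) ∘ X k) ν :=
        (hind.indepFun h).comp hφ (continuous_star.measurable.comp hφ)
      have := hi.integral_mul_eq_mul_integral (hφ.comp (hX j)).aestronglyMeasurable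
        ((continuous_star.measurable.comp hφ).comp (hX k)).aestronglyMeasurable
      have h0 : ∫ p, (φ ∘ X j) p ∂ν = 0 :=
        integral_exp_mul_I_of_isUniform (hX j).aemeasurable (hu j)
      rw [h0, zero_mul] at this
      simpa [h] using this
  apply Complex.ofReal_injective
  rw [← integral_complex_ofReal]
  simp_rw [hpt]
  rw [integral_finsetSum _ fun j _ => integrable_finsetSum _ fun k _ => hint j k]
  simp_rw [integral_finsetSum Finset.univ fun k _ => hint _ k, integral_const_mul, hjk]
  simp [sq]

end Phases

/-! ### Measurability and Haar invariance -/

section Measurability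

variable {d m t : ℕ}

instance haarU_isHaarMeasure : (haarU d).IsHaarMeasure := by
  unfold haarU; infer_instance

instance haarU_isProbabilityMeasure : IsProbabilityMeasure (haarU d) :=
  ⟨by simpa [haarU] using
    Measure.haarMeasure_self (K₀ := (⊤ : TopologicalSpace.PositiveCompacts (UGroup d)))⟩

/-- A right translate of Haar measure is again a Haar probability measure, so uniqueness applies. -/
lemma measurePreserving_haarU_mul_right (T : UGroup d) :
    MeasurePreserving (fun U => U * T) (haarU d) (haarU d) := by
  have hm : Measurable fun U : UGroup d => U * T := (continuous_mul_const T).measurable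
  refine ⟨hm, ?_⟩
  have := Measure.isProbabilityMeasure_map (μ := haarU d) hm.aemeasurable
  exact Measure.isHaarMeasure_eq_of_isProbabilityMeasure _ _

lemma measurable_entry (i j : Fin d) : Measurable fun U : UGroup d => U.1 i j :=
  (Continuous.matrix_elem continuous_subtype_val i j).measurable

lemma measurable_actX_entries {α : Type*} [MeasurableSpace α]
    {A : α → Matrix (Fin d) (Fin d) ℂ} (hA : ∀ i j, Measurable fun x => A x i j)
    {ψ : α → HXR d m} (hψ : Measurable ψ) : Measurable fun x => actX (A x) (ψ x) := by
  refine (MeasurableEquiv.toLp 2 (Fin d × Fin m → ℂ)).measurable.comp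
    (g := MeasurableEquiv.toLp 2 (Fin d × Fin m → ℂ))
    (f := fun x => (actX (A x) (ψ x)).ofLp) (measurable_pi_lambda _ fun ⟨a, b⟩ => ?_)
  simp only [actX_apply]
  refine Finset.measurable_sum _ fun a' _ => (hA a a').mul ?_
  exact (EuclideanSpace.proj (𝕜 := ℂ) (a', b)).continuous.measurable.comp hψ

lemma measurable_star_mul_entry {α : Type*} [MeasurableSpace α] {U V : α → UGroup d}
    (hU : Measurable U) (hV : Measurable V) (i j : Fin d) :
    Measurable fun x => (star (U x).1 * (V x).1) i j := by
  simp only [Matrix.mul_apply, Matrix.star_apply]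
  exact Finset.measurable_sum _ fun k _ =>
    (continuous_star.measurable.comp ((measurable_entry k i).comp hU)).mul
      ((measurable_entry k j).comp hV)

lemma measurable_trace {α : Type*} [MeasurableSpace α] {U V : α → UGroup d}
    (hU : Measurable U) (hV : Measurable V) :
    Measurable fun x => (star (U x).1 * (V x).1).trace := by
  simp only [Matrix.trace, Matrix.diag_apply]
  exact Finset.measurable_sum _ fun i _ => measurable_star_mul_entry hU hV i i

lemma measurable_phase {α : Type*} [MeasurableSpace α] {U V : α → UGroup d} {ψ : α → HXR d m}
    (hU : Measurable U) (hV : Measurable V) (hψ : Measurable ψ) :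
    Measurable fun x => phase (U x) (V x) (ψ x) := by
  refine Complex.measurable_arg.comp ?_
  exact hψ.inner (measurable_actX_entries (measurable_star_mul_entry hU hV) hψ)

lemma measurable_trainingSet {α : Type*} [MeasurableSpace α] {U : α → UGroup d}
    {S : α → Fin t → HXR d m} (hU : Measurable U) (hS : Measurable S) :
    Measurable fun x => trainingSet (U x) (S x) :=
  measurable_pi_lambda _ fun j => ((measurable_pi_apply j).comp hS).prodMk
    (measurable_actX_entries (fun a b => (measurable_entry a b).comp hU)
      ((measurable_pi_apply j).comp hS))

lemma norm_trace_le (W : UGroup d) : ‖W.1.trace‖ ≤ d :=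
  calc ‖W.1.trace‖ ≤ ∑ i, ‖W.1 i i‖ := norm_sum_le _ _
    _ ≤ ∑ _i : Fin d, (1 : ℝ) :=
      Finset.sum_le_sum fun i _ => entry_norm_bound_of_unitary W.2 i i
    _ = d := by simp

lemma integrable_norm_sq_trace {α : Type*} [MeasurableSpace α] {ν : Measure α}
    [IsFiniteMeasure ν] {U V : α → UGroup d} (hU : Measurable U) (hV : Measurable V) :
    Integrable (fun x => ‖(star (U x).1 * (V x).1).trace‖ ^ 2) ν := by
  refine Integrable.of_bound (C := (d : ℝ) ^ 2)
    ((measurable_trace hU hV).norm.pow_const 2).aestronglyMeasurable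
    (Filter.Eventually.of_forall fun x => ?_)
  rw [Real.norm_of_nonneg (by positivity)]
  exact pow_le_pow_left₀ (norm_nonneg _) (norm_trace_le (star (U x) * V x)) 2

lemma integrable_norm_sq_sum_exp {α ι : Type*} [MeasurableSpace α] [Fintype ι] {ν : Measure α}
    [IsFiniteMeasure ν] (c : ι → ℝ) {X : ι → α → ℝ} (hX : ∀ j, Measurable (X j)) :
    Integrable (fun x => ‖∑ j, (c j : ℂ) * Complex.exp (X j x * Complex.I)‖ ^ 2) ν := by
  refine Integrable.of_bound (C := (∑ j, |c j|) ^ 2) ?_ (Filter.Eventually.of_forall fun x => ?_)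
  · refine Measurable.aestronglyMeasurable ?_
    fun_prop
  · rw [Real.norm_of_nonneg (by positivity)]
    refine pow_le_pow_left₀ (norm_nonneg _) ((norm_sum_le _ _).trans_eq ?_) 2
    refine Finset.sum_congr rfl fun j _ => ?_
    rw [norm_mul, Complex.norm_exp_ofReal_mul_I, mul_one, Complex.norm_real, Real.norm_eq_abs]

end Measurability

/-! ### The expected squared trace -/

section ExpectedTrace

variable {d m t : ℕ} {r : Fin t → ℕ}

lemma exists_schmidtFamily {S : Fin t → HXR d m} (hS : S ∈ orthoInputs d m t r) :
    ∃ ξ : ∀ j, Fin (r j) → HX d, ∀ j, Orthonormal ℂ (ξ j) ∧ IsSchmidtFamily (S j) (ξ j) := by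
  have h : ∀ j, ∃ ξ : Fin (r j) → HX d, Orthonormal ℂ ξ ∧ IsSchmidtFamily (S j) ξ := by
    intro j
    obtain ⟨c, ξ, ζ, hc, hξ, hζ, h⟩ := hS.2 j
    exact ⟨ξ, hξ, c, ζ, hc, hζ, h⟩
  choose ξ hξ using h
  exact ⟨ξ, hξ⟩

lemma act_schmidt_eq_smul (ht : 1 ≤ t) {U V : UGroup d} {S : Fin t → HXR d m}
    (hS : Orthonormal ℂ S) (hloss : loss U V S = 0) {ξ : ∀ j, Fin (r j) → HX d}
    (hξ : ∀ j, IsSchmidtFamily (S j) (ξ j)) (j : Fin t) (k : Fin (r j)) :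
    act (star U * V).1 (ξ j k) = overlap U V (S j) • ξ j k :=
  (hξ j).act_eq_smul (actX_eq_overlap_smul (hS.1 j) (norm_overlap_eq_one ht hS hloss j)) k

lemma orthonormal_schmidt (ht : 1 ≤ t) {U V : UGroup d} {S : Fin t → HXR d m}
    (hS : Orthonormal ℂ S) (hloss : loss U V S = 0)
    (hne : ∀ i j, i ≠ j → phase U V (S i) ≠ phase U V (S j)) {ξ : ∀ j, Fin (r j) → HX d}
    (hξ : ∀ j, Orthonormal ℂ (ξ j) ∧ IsSchmidtFamily (S j) (ξ j)) :
    Orthonormal ℂ fun p : Σ j, Fin (r j) => ξ p.1 p.2 := by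
  refine ⟨fun p => (hξ p.1).1.1 p.2, ?_⟩
  rintro ⟨i, k⟩ ⟨j, l⟩ hp
  by_cases hij : i = j
  · subst hij
    exact (hξ i).1.2 fun h => hp (Sigma.ext rfl (heq_of_eq h))
  · have hact := act_schmidt_eq_smul ht hS hloss fun j => (hξ j).2
    refine inner_eq_zero_of_act_eq_smul (star U * V) (hact i k) (hact j l)
      (norm_overlap_eq_one ht hS hloss i) fun h => hne i j hij ?_
    rw [phase, phase, h]

/-- Averaging over finitely many right translations. -/
lemma integral_haarU_le_of_sum_mul_right_le {A : Type*} [Fintype A] [Nonempty A]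
    (T : A → UGroup d) {F G : UGroup d → ℝ} (hF : Integrable F (haarU d))
    (hG : Integrable G (haarU d))
    (h : ∀ᵐ U ∂(haarU d), ∑ a, F (U * T a) ≤ Fintype.card A * (G U + 1)) :
    ∫ U, F U ∂(haarU d) ≤ ∫ U, G U ∂(haarU d) + 1 := by
  have hFT : ∀ a, Integrable (fun U => F (U * T a)) (haarU d) := fun a =>
    (measurePreserving_haarU_mul_right (T a)).integrable_comp_of_integrable hF
  have hinv : ∀ a, ∫ U, F (U * T a) ∂(haarU d) = ∫ U, F U ∂(haarU d) := by
    intro a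
    have hmp := measurePreserving_haarU_mul_right (T a)
    have := integral_map (f := F) hmp.measurable.aemeasurable
      (by rw [hmp.map_eq]; exact hF.aestronglyMeasurable)
    rw [← this, hmp.map_eq]
  have hN : (0 : ℝ) < Fintype.card A := by exact_mod_cast Fintype.card_pos
  have hle := integral_mono_ae (integrable_finsetSum _ fun a _ => hFT a)
    ((hG.add (integrable_const 1)).const_mul (Fintype.card A : ℝ)) h
  rw [integral_finsetSum _ fun a _ => hFT a, integral_const_mul] at hle
  simp only [hinv, Finset.sum_const, Finset.card_univ, nsmul_eq_mul] at hle
  have := le_of_mul_le_mul_left hle hN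
  simp only [Pi.add_apply] at this
  rwa [integral_add hG (integrable_const _), integral_const, probReal_univ, one_smul] at this

lemma integral_one_sub_add_div {α : Type*} [MeasurableSpace α] {ν : Measure α}
    [IsProbabilityMeasure ν] {F : α → ℝ} (hF : Integrable F ν) (b c : ℝ) :
    ∫ x, (1 - (F x + b) / c) ∂ν = 1 - (∫ x, F x ∂ν + b) / c := by
  rw [integral_sub (integrable_const _), integral_div, integral_add hF (integrable_const _)]
  · simp
  · exact (hF.add (integrable_const _)).div_const _

/-- The conditional expectation of the squared trace, given the inputs and the internal
randomness. -/
lemma integral_haarU_norm_sq_trace_le (ht : 1 ≤ t) {S : Fin t → HXR d m}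
    (hS : S ∈ orthoInputs d m t r) {f : (Fin t → HXR d m × HXR d m) → UGroup d}
    (hf : Measurable f) (hloss : ∀ᵐ U ∂(haarU d), loss U (f (trainingSet U S)) S = 0)
    (hne : ∀ᵐ U ∂(haarU d), ∀ i j, i ≠ j →
      phase U (f (trainingSet U S)) (S i) ≠ phase U (f (trainingSet U S)) (S j)) :
    ∫ U, ‖(star U.1 * (f (trainingSet U S)).1).trace‖ ^ 2 ∂(haarU d) ≤
      ∫ U, ‖∑ j, ((r j : ℝ) : ℂ) *
        Complex.exp (phase U (f (trainingSet U S)) (S j) * Complex.I)‖ ^ 2 ∂(haarU d) + 1 := by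
  obtain ⟨ξ, hξ⟩ := exists_schmidtFamily hS
  -- Orthonormality of the joint Schmidt family concerns `S` alone, so a single good target `U₀`
  -- establishes it, and one twirl then serves all `U`.
  obtain ⟨U₀, h₀, h₀'⟩ := (hloss.and hne).exists
  obtain ⟨A, _, _, T, hT, hW⟩ := exists_twirl (orthonormal_schmidt ht hS.1 h₀ h₀' hξ)
  have hV : Measurable fun U : UGroup d => f (trainingSet U S) :=
    hf.comp (measurable_trainingSet measurable_id measurable_const)
  -- The algorithm cannot tell `U * T a` from `U`: both act alike on every input.
  have hTS : ∀ (a : A) (U : UGroup d), trainingSet (U * T a) S = trainingSet U S := by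
    intro a U
    ext1 j
    have h : actX (T a).1 (S j) = S j := (hξ j).2.actX_eq_self fun k => hT a ⟨j, k⟩
    change (S j, actX (U.1 * (T a).1) (S j)) = (S j, actX U.1 (S j))
    rw [actX_mul, h]
  refine integral_haarU_le_of_sum_mul_right_le T (integrable_norm_sq_trace measurable_id hV)
    (integrable_norm_sq_sum_exp (fun j => (r j : ℝ))
      fun j => measurable_phase measurable_id hV measurable_const) ?_
  filter_upwards [hloss] with U hU
  simp only [hTS]
  generalize f (trainingSet U S) = W at hU
  have hno := norm_overlap_eq_one ht hS.1 hU
  have h := hW (star U * W) (fun p => overlap U W (S p.1))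
    fun p => act_schmidt_eq_smul ht hS.1 hU (fun j => (hξ j).2) p.1 p.2
  have hsum : ∑ p : Σ j, Fin (r j), overlap U W (S p.1) =
      ∑ j, ((r j : ℝ) : ℂ) * Complex.exp (phase U W (S j) * Complex.I) := by
    rw [Fintype.sum_sigma]
    refine Finset.sum_congr rfl fun j _ => ?_
    rw [← overlap_eq_exp_phase (hno j)]
    simp
  rw [hsum] at h
  refine le_trans (le_of_eq (Finset.sum_congr rfl fun a _ => ?_)) h
  have : star (U * T a).1 * W.1 = star (T a).1 * (star U * W).1 := by
    change star (U.1 * (T a).1) * W.1 = star (T a).1 * (star U.1 * W.1)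
    rw [star_mul, mul_assoc]
  rw [this]

/-- The twirl depends on `S`, so the comparison is made for fixed inputs and randomness, with the
integral over `U` innermost. The phases are independent and uniform only under the joint law, so `∑
rⱼ²` enters as an integral over the whole product. -/
theorem integral_norm_sq_trace_le (ht : 1 ≤ t) (μ : Measure (Fin t → HXR d m))
    [IsProbabilityMeasure μ] (hμ : ∀ᵐ S ∂μ, S ∈ orthoInputs d m t r)
    {Ω : Type*} [MeasurableSpace Ω] (P : Measure Ω) [IsProbabilityMeasure P]
    (V : (Fin t → HXR d m × HXR d m) × Ω → UGroup d) (hV : Measurable V)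
    (hloss : ∀ᵐ p ∂((haarU d).prod (μ.prod P)),
      loss p.1 (V (trainingSet p.1 p.2.1, p.2.2)) p.2.1 = 0)
    (hindep : iIndepFun
      (fun (j : Fin t) (p : UGroup d × (Fin t → HXR d m) × Ω) =>
        phase p.1 (V (trainingSet p.1 p.2.1, p.2.2)) (p.2.1 j))
      ((haarU d).prod (μ.prod P)))
    (hunif : ∀ j : Fin t, pdf.IsUniform
      (fun p : UGroup d × (Fin t → HXR d m) × Ω =>
        phase p.1 (V (trainingSet p.1 p.2.1, p.2.2)) (p.2.1 j))
      (Set.Ioc (-Real.pi) Real.pi) ((haarU d).prod (μ.prod P)) volume) :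
    ∫ p : UGroup d × (Fin t → HXR d m) × Ω,
      ‖(star p.1.1 * (V (trainingSet p.1 p.2.1, p.2.2)).1).trace‖ ^ 2
        ∂((haarU d).prod (μ.prod P)) ≤ ∑ j, (r j : ℝ) ^ 2 + 1 := by
  have hS : Measurable fun p : UGroup d × (Fin t → HXR d m) × Ω => p.2.1 :=
    measurable_fst.comp measurable_snd
  have hVm : Measurable fun p : UGroup d × (Fin t → HXR d m) × Ω =>
      V (trainingSet p.1 p.2.1, p.2.2) :=
    hV.comp ((measurable_trainingSet measurable_fst hS).prodMk
      (measurable_snd.comp measurable_snd))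
  have hph : ∀ j : Fin t, Measurable fun p : UGroup d × (Fin t → HXR d m) × Ω =>
      phase p.1 (V (trainingSet p.1 p.2.1, p.2.2)) (p.2.1 j) := fun j =>
    measurable_phase measurable_fst hVm ((measurable_pi_apply j).comp hS)
  have hne : ∀ᵐ p ∂((haarU d).prod (μ.prod P)), ∀ i j, i ≠ j →
      phase p.1 (V (trainingSet p.1 p.2.1, p.2.2)) (p.2.1 i) ≠
        phase p.1 (V (trainingSet p.1 p.2.1, p.2.2)) (p.2.1 j) := by
    refine ae_all_iff.2 fun i => ae_all_iff.2 fun j => ?_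
    by_cases hij : i = j
    · exact Filter.Eventually.of_forall fun _ h => absurd hij h
    · filter_upwards [ae_ne_of_indepFun_isUniform (hph i).aemeasurable (hph j).aemeasurable
        (hindep.indepFun hij) (hunif j)] with p hp _ using hp
  have hF := integrable_norm_sq_trace (ν := (haarU d).prod (μ.prod P)) measurable_fst hVm
  have hG := integrable_norm_sq_sum_exp (ν := (haarU d).prod (μ.prod P)) (fun j => (r j : ℝ)) hph
  have hswap := Measure.measurePreserving_swap (μ := μ.prod P) (ν := haarU d)
  have hae := Measure.ae_ae_of_ae_prod (hswap.quasiMeasurePreserving.ae (hloss.and hne))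
  have hSae : ∀ᵐ q ∂(μ.prod P), q.1 ∈ orthoInputs d m t r :=
    Measure.quasiMeasurePreserving_fst.ae hμ
  rw [← integral_norm_sq_sum_exp (fun j => (r j : ℝ)) hph hindep hunif,
    integral_prod_symm _ hF, integral_prod_symm _ hG]
  have hG' := hG.integral_prod_right
  refine (integral_mono_ae hF.integral_prod_right (hG'.add (integrable_const 1)) ?_).trans_eq ?_
  · filter_upwards [hae, hSae] with q hq hqS
    exact integral_haarU_norm_sq_trace_le (f := fun s => V (s, q.2)) ht hqS
      (hV.comp (measurable_id.prodMk measurable_const)) (hq.mono fun _ h => h.1)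
      (hq.mono fun _ h => h.2)
  · simp only [Pi.add_apply]
    rw [integral_add hG' (integrable_const _), integral_const, probReal_univ, one_smul]

end ExpectedTrace

theorem expectedRisk_eq {d m t : ℕ} [NeZero d] (μ : Measure (Fin t → HXR d m))
    [IsProbabilityMeasure μ] {Ω : Type*} [MeasurableSpace Ω] (P : Measure Ω)
    [IsProbabilityMeasure P] (V : (Fin t → HXR d m × HXR d m) × Ω → UGroup d)
    (hV : Measurable V) :
    expectedRisk μ P V = 1 - (∫ p : UGroup d × (Fin t → HXR d m) × Ω,
      ‖(star p.1.1 * (V (trainingSet p.1 p.2.1, p.2.2)).1).trace‖ ^ 2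
        ∂((haarU d).prod (μ.prod P)) + d) / (d * (d + 1)) := by
  have hS : Measurable fun p : UGroup d × (Fin t → HXR d m) × Ω => p.2.1 :=
    measurable_fst.comp measurable_snd
  have hVm : Measurable fun p : UGroup d × (Fin t → HXR d m) × Ω =>
      V (trainingSet p.1 p.2.1, p.2.2) :=
    hV.comp ((measurable_trainingSet measurable_fst hS).prodMk
      (measurable_snd.comp measurable_snd))
  have hF := integrable_norm_sq_trace (ν := (haarU d).prod (μ.prod P)) measurable_fst hVm
  have hrisk : ∀ p : UGroup d × (Fin t → HXR d m) × Ω,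
      risk p.1 (V (trainingSet p.1 p.2.1, p.2.2)) =
        1 - (‖(star p.1.1 * (V (trainingSet p.1 p.2.1, p.2.2)).1).trace‖ ^ 2 + d) /
          (d * (d + 1)) := fun p => risk_eq _ _
  have hint : Integrable (fun p : UGroup d × (Fin t → HXR d m) × Ω =>
      risk p.1 (V (trainingSet p.1 p.2.1, p.2.2))) ((haarU d).prod (μ.prod P)) := by
    simp only [hrisk]
    exact (integrable_const _).sub ((hF.add (integrable_const _)).div_const _)
  have hiter : expectedRisk μ P V = ∫ p : UGroup d × (Fin t → HXR d m) × Ω,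
      risk p.1 (V (trainingSet p.1 p.2.1, p.2.2)) ∂((haarU d).prod (μ.prod P)) := by
    rw [integral_prod _ hint, expectedRisk]
    refine integral_congr_ae ?_
    filter_upwards [hint.prod_right_ae] with U hU
    rw [integral_prod _ hU]
  rw [hiter]
  simp only [hrisk]
  exact integral_one_sub_add_div hF _ _

end QNN

end

theorem mainTheorem3 {d m t : ℕ} (ht : 1 ≤ t) (r : Fin t → ℕ)
    -- the distribution of the pairwise orthogonal training inputs
    (μ : Measure (Fin t → QNN.HXR d m)) [IsProbabilityMeasure μ]
    (hμ : ∀ᵐ S ∂μ, S ∈ QNN.orthoInputs d m t r)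
    -- the training algorithm and its internal randomness
    {Ω : Type*} [MeasurableSpace Ω] (P : Measure Ω) [IsProbabilityMeasure P]
    (V : (Fin t → QNN.HXR d m × QNN.HXR d m) × Ω → QNN.UGroup d) (hV : Measurable V)
    -- perfect training
    (hloss : ∀ᵐ p ∂((QNN.haarU d).prod (μ.prod P)),
      QNN.loss p.1 (V (QNN.trainingSet p.1 p.2.1, p.2.2)) p.2.1 = 0)
    -- the learned phases are independent and uniformly distributed on `(-π, π]`
    (hindep : iIndepFun
      (fun (j : Fin t) (p : QNN.UGroup d × (Fin t → QNN.HXR d m) × Ω) =>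
        QNN.phase p.1 (V (QNN.trainingSet p.1 p.2.1, p.2.2)) (p.2.1 j))
      ((QNN.haarU d).prod (μ.prod P)))
    (hunif : ∀ j : Fin t, pdf.IsUniform
      (fun p : QNN.UGroup d × (Fin t → QNN.HXR d m) × Ω =>
        QNN.phase p.1 (V (QNN.trainingSet p.1 p.2.1, p.2.2)) (p.2.1 j))
      (Set.Ioc (-Real.pi) Real.pi) ((QNN.haarU d).prod (μ.prod P)) volume) :
    1 - ((∑ j, (r j : ℝ) ^ 2) + d + 1) / (d * (d + 1)) ≤ QNN.expectedRisk μ P V ∧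
    ∀ r₀ : ℕ, (∀ j, r j = r₀) →
      1 - ((r₀ : ℝ) ^ 2 * t + d + 1) / (d * (d + 1)) ≤ QNN.expectedRisk μ P V ∧
      1 - ((r₀ : ℝ) ^ 2 * t + d + 1) / (d * (d + 1)) =
        (1 - 1 / (d : ℝ)) - (r₀ : ℝ) ^ 2 / (d * (d + 1)) * t := by
  -- For `d = 0` the input space is zero and has no unit vector, whereas `1 ≤ t` provides one.
  have hd : NeZero d := by
    refine ⟨?_⟩
    rintro rfl
    obtain ⟨S, hS⟩ := hμ.exists
    have h := hS.1.1 ⟨0, ht⟩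
    rw [Subsingleton.elim (S ⟨0, ht⟩) 0, norm_zero] at h
    exact zero_ne_one h
  have hd0 : (0 : ℝ) < d := by exact_mod_cast Nat.pos_of_ne_zero hd.out
  have hmain : 1 - ((∑ j, (r j : ℝ) ^ 2) + d + 1) / (d * (d + 1)) ≤ QNN.expectedRisk μ P V := by
    rw [QNN.expectedRisk_eq μ P V hV]
    have h := QNN.integral_norm_sq_trace_le ht μ hμ P V hV hloss hindep hunif
    have hle := div_le_div_of_nonneg_right (add_le_add_left h (d : ℝ))
      (by positivity : (0 : ℝ) ≤ d * (d + 1))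
    have heq : (∑ j, (r j : ℝ) ^ 2) + d + 1 = (∑ j, (r j : ℝ) ^ 2) + 1 + d := by ring
    rw [heq]
    linarith
  refine ⟨hmain, fun r₀ hr => ⟨?_, ?_⟩⟩
  · have hsum : ∑ j, (r j : ℝ) ^ 2 = (r₀ : ℝ) ^ 2 * t := by
      simp [hr, mul_comm]
    rwa [hsum] at hmain
  · field_simp
    ring
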